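/- For a finite group $G$, the power graph $\mathrm{Pow}(G)$ is the simple undirected graph with vertex set $G$ in which two distinct elements $x,y$ are adjacent if and only if $y=x^m$ or $x=y^m$ for some integer $m$. An orientation $\mathcal O$ of an undirected graph $X$ assigns exactly one direction to each edge of $X$, giving a directed graph $X_{\mathcal O}$. The diameter $\mathrm{diam}(X_{\mathcal O})$ is the maximum over all ordered pairs $(u,v)$ of vertices of the length of a shortest directed path from $u$ to $v$, taken to be $\infty$ if for some pair there is no such path. The oriented diameter $OD(X)$ is the minimum of $\mathrm{diam}(X_{\mathcal O})$ over all orientations $\mathcal O$ of $X$. **Lemma.** Let $G$ be a finite non-cyclic nilpotent group whose order is not a power of a prime. Then $OD(\mathrm{Pow}(G))\ge 3$. -/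

import Mathlib

namespace OrientedDiameter

/-- The power graph `Pow(G)`: distinct `x`, `y` are adjacent iff one of them is an integer power
of the other. -/
def powerGraph (G : Type*) [Group G] : SimpleGraph G :=
  SimpleGraph.fromRel fun x y => ∃ m : ℤ, y = x ^ m

/-- `D` is an orientation of the simple graph `X`: its arcs join exactly the adjacent pairs of `X`,
and every edge of `X` receives exactly one of its two directions. -/
structure IsOrientation {V : Type*} (X : SimpleGraph V) (D : Digraph V) : Prop where
  adj_iff : ∀ u v, X.Adj u v ↔ D.Adj u v ∨ D.Adj v u
  asymm : ∀ u v, D.Adj u v → ¬ D.Adj v u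

/-- There is a directed path `u = p 0, p 1, …, p n = v` of length `n` (with distinct vertices)
from `u` to `v` in the directed graph `D`. -/
def HasDirectedPath {V : Type*} (D : Digraph V) (u v : V) (n : ℕ) : Prop :=
  ∃ p : Fin (n + 1) → V, Function.Injective p ∧ p 0 = u ∧ p (Fin.last n) = v ∧
    ∀ i : Fin n, D.Adj (p i.castSucc) (p i.succ)

/-- The length of a shortest directed path from `u` to `v` in `D`; it is `⊤` if there is none. -/
noncomputable def directedDist {V : Type*} (D : Digraph V) (u v : V) : ℕ∞ :=
  ⨅ (n : ℕ) (_ : HasDirectedPath D u v n), (n : ℕ∞)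

/-- The diameter of a directed graph. -/
noncomputable def directedDiam {V : Type*} (D : Digraph V) : ℕ∞ :=
  ⨆ (u : V) (v : V), directedDist D u v

/-- The oriented diameter `OD(X)`: the minimum diameter of an orientation of `X`. -/
noncomputable def orientedDiam {V : Type*} (X : SimpleGraph V) : ℕ∞ :=
  ⨅ (D : Digraph V) (_ : IsOrientation X D), directedDiam D

end OrientedDiameter

open Subgroup

namespace OrientedDiameter

/-! ### Oriented diameter and common neighbours -/

section Digraph

variable {V : Type*}

/-! A nilpotent group whose Sylow subgroups are all cyclic is cyclic, so some Sylow `p`-subgroup is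
non-cyclic. It contains either two distinct subgroups of order `p` or a quaternion group of order 8
(`exists_prime_order_pair_or_quaternion`).

In an orientation of diameter at most 2, non-adjacent vertices are joined by 2-paths in both
directions, and one common neighbour cannot serve both. Generators of distinct subgroups of order
`p` have only `1` as common neighbour. In the quaternion case `u`, `w`, `u * w` pairwise share at
most `1` and `u ^ 2`, and two middle vertices cannot serve three pairs in both directions. -/

theorem HasDirectedPath.eq_or_adj_or_exists {D : Digraph V} {u v : V} {n : ℕ}
    (h : HasDirectedPath D u v n) (hn : n < 3) :
    u = v ∨ D.Adj u v ∨ ∃ w, D.Adj u w ∧ D.Adj w v := by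
  obtain ⟨p, -, rfl, rfl, h⟩ := h
  interval_cases n
  · exact Or.inl rfl
  · exact Or.inr (Or.inl (h 0))
  · exact Or.inr (Or.inr ⟨p 1, h 0, h 1⟩)

theorem exists_orientation_of_orientedDiam_lt_three {X : SimpleGraph V}
    (h : orientedDiam X < 3) :
    ∃ D : Digraph V, IsOrientation X D ∧
      ∀ u v, u ≠ v → ¬ X.Adj u v → ∃ w, D.Adj u w ∧ D.Adj w v := by
  simp only [orientedDiam, iInf_lt_iff] at h
  obtain ⟨D, hD, h⟩ := h
  refine ⟨D, hD, fun u v huv hadj ↦ ?_⟩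
  have hlt : directedDist D u v < 3 :=
    (le_iSup₂ (f := fun u v ↦ directedDist D u v) u v).trans_lt h
  simp only [directedDist, iInf_lt_iff] at hlt
  obtain ⟨n, hp, hn⟩ := hlt
  rcases hp.eq_or_adj_or_exists (by exact_mod_cast hn) with h | h | h
  · exact absurd h huv
  · exact absurd ((hD.adj_iff u v).2 (Or.inl h)) hadj
  · exact h

theorem three_le_orientedDiam_of_common_neighbor_unique {X : SimpleGraph V} {u v c : V}
    (huv : u ≠ v) (hadj : ¬ X.Adj u v) (hc : ∀ z, X.Adj u z → X.Adj v z → z = c) :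
    3 ≤ orientedDiam X := by
  by_contra! h
  obtain ⟨D, hD, h⟩ := exists_orientation_of_orientedDiam_lt_three h
  obtain ⟨z, hz₁, hz₂⟩ := h u v huv hadj
  obtain ⟨z', hz₁', hz₂'⟩ := h v u huv.symm fun h ↦ hadj h.symm
  obtain rfl := hc z ((hD.adj_iff _ _).2 (.inl hz₁)) ((hD.adj_iff _ _).2 (.inr hz₂))
  obtain rfl := hc z' ((hD.adj_iff _ _).2 (.inr hz₂')) ((hD.adj_iff _ _).2 (.inl hz₁'))
  exact hD.asymm _ _ hz₁ hz₂'

theorem three_le_orientedDiam_of_three_vertices {X : SimpleGraph V} {c d : V} (x : Fin 3 → V)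
    (hne : ∀ i j, i ≠ j → x i ≠ x j) (hadj : ∀ i j, i ≠ j → ¬ X.Adj (x i) (x j))
    (hc : ∀ i j, i ≠ j → ∀ z, X.Adj (x i) z → X.Adj (x j) z → z = c ∨ z = d) :
    3 ≤ orientedDiam X := by
  by_contra! h
  obtain ⟨D, hD, h⟩ := exists_orientation_of_orientedDiam_lt_three h
  have key : ∀ i j, i ≠ j → (D.Adj (x i) c ∧ D.Adj c (x j)) ∨ (D.Adj (x i) d ∧ D.Adj d (x j)) := by
    intro i j hij
    obtain ⟨z, hz₁, hz₂⟩ := h _ _ (hne i j hij) (hadj i j hij)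
    rcases hc i j hij z ((hD.adj_iff _ _).2 (.inl hz₁)) ((hD.adj_iff _ _).2 (.inr hz₂)) with
      rfl | rfl
    · exact .inl ⟨hz₁, hz₂⟩
    · exact .inr ⟨hz₁, hz₂⟩
  -- One of `c`, `d` carries the path from `x i` to `x j` and the other the reverse path, so exactly
  -- one of the two arcs at `c` points into `c`. Three vertices cannot pairwise differ in a
  -- two-valued property.
  have hxor : ∀ i j, i ≠ j → (D.Adj (x i) c ↔ ¬ D.Adj (x j) c) := by
    intro i j hij
    have h₁ := hD.asymm (x i) c
    have h₂ := hD.asymm (x j) c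
    have h₃ := hD.asymm (x i) d
    rcases key i j hij with h | h <;> rcases key j i hij.symm with h' | h' <;> tauto
  have h₁ := hxor 0 1 (by decide)
  have h₂ := hxor 1 2 (by decide)
  have h₃ := hxor 0 2 (by decide)
  tauto

end Digraph

/-! ### Common neighbours in the power graph -/

section PowerGraph

variable {G : Type*} [Group G]

theorem powerGraph_adj {x y : G} :
    (powerGraph G).Adj x y ↔ x ≠ y ∧ (y ∈ zpowers x ∨ x ∈ zpowers y) := by
  simp [powerGraph, SimpleGraph.fromRel_adj, mem_zpowers_iff, eq_comm]

theorem zpow_eq_one_or_self {q : G} (hq : q ^ 2 = 1) (n : ℤ) : q ^ n = 1 ∨ q ^ n = q := by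
  have h2 : q ^ (2 : ℤ) = 1 := by exact_mod_cast hq
  rcases Int.even_or_odd' n with ⟨m, rfl | rfl⟩
  · simp [zpow_mul, h2]
  · simp [zpow_add, zpow_mul, h2]

theorem commute_of_mem_zpowers {a b z : G} (ha : a ∈ zpowers z) (hb : b ∈ zpowers z) :
    Commute a b := by
  obtain ⟨i, rfl⟩ := ha
  obtain ⟨j, rfl⟩ := hb
  exact Commute.zpow_zpow_self z i j

theorem mem_zpowers_of_mem_zpowers_of_pow_prime_eq_one {p : ℕ} (hp : p.Prime) {a b : G}
    (hb : b ^ p = 1) (hab : a ∈ zpowers b) (ha : a ≠ 1) : b ∈ zpowers a := by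
  obtain ⟨k, rfl⟩ := hab
  have hb1 : b ≠ 1 := by rintro rfl; simp at ha
  have := Fact.mk hp
  have hord := orderOf_eq_prime hb hb1
  simp only at ha ⊢
  rw [mem_zpowers_zpow_iff, hord, ← Int.isCoprime_iff_gcd_eq_one, isCoprime_comm,
    (Nat.prime_iff_prime_int.1 hp).coprime_iff_not_dvd]
  rw [← hord]
  exact fun h ↦ ha (orderOf_dvd_iff_zpow_eq_one.1 h)

/-- A cyclic group has at most one subgroup of order `p`: here it is generated by `z ^ M` with
`orderOf z = p * M`. -/
theorem mem_zpowers_of_pow_prime_eq_one {p : ℕ} (hp : p.Prime) {a b z : G}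
    (haz : a ∈ zpowers z) (hbz : b ∈ zpowers z) (hap : a ^ p = 1) (hbp : b ^ p = 1) (ha : a ≠ 1) :
    b ∈ zpowers a := by
  have hp' := Nat.prime_iff_prime_int.1 hp
  obtain ⟨i, rfl⟩ := haz
  obtain ⟨j, rfl⟩ := hbz
  simp only at *
  rw [← zpow_natCast, ← zpow_mul, ← orderOf_dvd_iff_zpow_eq_one] at hap hbp
  have hpN : (p : ℤ) ∣ orderOf z := by
    by_contra h
    exact ha (orderOf_dvd_iff_zpow_eq_one.1
      (((hp'.coprime_iff_not_dvd.2 h).symm).dvd_of_dvd_mul_right hap))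
  obtain ⟨M, hM⟩ := hpN
  have hp0 : (p : ℤ) ≠ 0 := hp'.ne_zero
  rw [hM, mul_comm, mul_dvd_mul_iff_right hp0] at hap hbp
  obtain ⟨i, rfl⟩ := hap
  obtain ⟨j, rfl⟩ := hbp
  have ht : (z ^ M) ^ p = 1 := by
    rw [← zpow_natCast, ← zpow_mul, mul_comm, ← hM, zpow_natCast, pow_orderOf_eq_one]
  have h := mem_zpowers_of_mem_zpowers_of_pow_prime_eq_one hp ht
    (a := z ^ (M * i)) ⟨i, by simp [zpow_mul]⟩ ha
  rw [zpow_mul z M j]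
  exact zpow_mem h j

theorem three_le_orientedDiam_of_prime_order {p : ℕ} (hp : p.Prime) {a b : G}
    (hap : a ^ p = 1) (hbp : b ^ p = 1) (ha : a ≠ 1) (hab : b ∉ zpowers a) :
    3 ≤ orientedDiam (powerGraph G) := by
  have hab' : a ∉ zpowers b := fun h ↦
    hab (mem_zpowers_of_mem_zpowers_of_pow_prime_eq_one hp hbp h ha)
  refine three_le_orientedDiam_of_common_neighbor_unique (u := a) (v := b) (c := 1) ?_ ?_ ?_
  · rintro rfl
    exact hab (mem_zpowers a)
  · rw [powerGraph_adj]
    tauto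
  · intro z hz₁ hz₂
    rw [powerGraph_adj] at hz₁ hz₂
    by_contra hz
    rcases hz₁.2 with h₁ | h₁ <;> rcases hz₂.2 with h₂ | h₂
    · have := mem_zpowers_of_mem_zpowers_of_pow_prime_eq_one hp hap h₁ hz
      exact hab' ((zpowers_le.2 h₂) this)
    · exact hab (zpowers_le.2 h₁ h₂)
    · exact hab' (zpowers_le.2 h₂ h₁)
    · exact hab (mem_zpowers_of_pow_prime_eq_one hp h₁ h₂ hap hbp ha)

/-- Elements of a common cyclic subgroup commute, so a common neighbour must be a power of both `a`
and `b`. It is an even power of `a`, since an odd power would generate `a`. -/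
theorem common_neighbor_of_not_commute {a b q : G} (ha : a ^ 2 = q) (hq : q ^ 2 = 1)
    (hab : ¬ Commute a b) :
    a ≠ b ∧ ¬ (powerGraph G).Adj a b ∧
      ∀ z, (powerGraph G).Adj a z → (powerGraph G).Adj b z → z = 1 ∨ z = q := by
  refine ⟨?_, ?_, ?_⟩
  · rintro rfl
    exact hab (Commute.refl a)
  · rw [powerGraph_adj]
    rintro ⟨-, h | h⟩
    · exact hab (commute_of_mem_zpowers (mem_zpowers a) h)
    · exact hab (commute_of_mem_zpowers h (mem_zpowers b))
  · intro z hz₁ hz₂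
    rw [powerGraph_adj] at hz₁ hz₂
    rcases hz₁.2 with h₁ | h₁ <;> rcases hz₂.2 with h₂ | h₂
    · have hz := commute_of_mem_zpowers h₂ (mem_zpowers b)
      obtain ⟨k, rfl⟩ := h₁
      simp only at hz ⊢
      rcases Int.even_or_odd' k with ⟨m, rfl | rfl⟩
      · have : a ^ (2 * m) = q ^ m := by rw [zpow_mul, ← ha]; norm_cast
        rw [this]
        exact zpow_eq_one_or_self hq m
      · exfalso
        -- An odd square is 1 modulo 4, and `a ^ 4 = 1`.
        have h4 : (a ^ (2 * m + 1)) ^ (2 * m + 1) = a := by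
          rw [← zpow_mul, show (2 * m + 1) * (2 * m + 1) = 2 * 2 * (m * m + m) + 1 by ring, zpow_add,
            zpow_mul, zpow_mul, show a ^ (2 : ℤ) = q by exact_mod_cast ha,
            show q ^ (2 : ℤ) = 1 by exact_mod_cast hq]
          simp
        exact hab (h4 ▸ hz.zpow_left (2 * m + 1))
    · exact absurd (commute_of_mem_zpowers (mem_zpowers a) (zpowers_le.2 h₁ h₂)) hab
    · exact absurd (commute_of_mem_zpowers (zpowers_le.2 h₂ h₁) (mem_zpowers b)) hab
    · exact absurd (commute_of_mem_zpowers h₁ h₂) hab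

theorem three_le_orientedDiam_of_quaternion {u w : G} (hu : u ^ 4 = 1) (huw : u ^ 2 = w ^ 2)
    (hrel : u * w = w * u * u ^ 2) (hne : ¬ Commute u w) :
    3 ≤ orientedDiam (powerGraph G) := by
  have hq : (u ^ 2) ^ 2 = 1 := by rw [← pow_mul]; exact hu
  have huw2 : (u * w) ^ 2 = u ^ 2 := by
    have h : w * u = u * w * u ^ 2 := by
      rw [hrel, mul_assoc, ← pow_add, hu, mul_one]
    calc (u * w) ^ 2 = u * (w * u) * w := by simp only [pow_two, mul_assoc]
      _ = u ^ 2 * (w * w ^ 2 * w) := by rw [h, huw]; simp only [pow_two, mul_assoc, ← huw]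
      _ = u ^ 2 * (w ^ 2) ^ 2 := by simp only [pow_two, mul_assoc]
      _ = u ^ 2 := by rw [← huw, hq, mul_one]
  have n₁ : ¬ Commute u (u * w) := fun h ↦ hne (by
    have := (Commute.refl u).inv_right.mul_right h
    simpa using this)
  have n₂ : ¬ Commute w (u * w) := fun h ↦ hne (by
    have := h.mul_right (Commute.refl w).inv_right
    simpa using this.symm)
  have key : ∀ i j : Fin 3, i ≠ j → ¬ Commute (![u, w, u * w] i) (![u, w, u * w] j) := by
    intro i j hij
    fin_cases i <;> fin_cases j
    exacts [absurd rfl hij, hne, n₁, fun h ↦ hne h.symm, absurd rfl hij, n₂, fun h ↦ n₁ h.symm,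
      fun h ↦ n₂ h.symm, absurd rfl hij]
  have sq : ∀ i : Fin 3, (![u, w, u * w] i) ^ 2 = u ^ 2 := by
    intro i
    fin_cases i <;> simp [huw, huw2]
  exact three_le_orientedDiam_of_three_vertices (c := 1) (d := u ^ 2) ![u, w, u * w]
    (fun i j hij ↦ (common_neighbor_of_not_commute (sq i) hq (key i j hij)).1)
    (fun i j hij ↦ (common_neighbor_of_not_commute (sq i) hq (key i j hij)).2.1)
    (fun i j hij ↦ (common_neighbor_of_not_commute (sq i) hq (key i j hij)).2.2)

end PowerGraph

/-! ### Structure of non-cyclic `p`-groups -/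

section PGroup

theorem index_eq_of_isCoatom {P : Type*} [Group P] [Finite P] {p : ℕ} [hp : Fact p.Prime]
    (hP : IsPGroup p P) {M : Subgroup P} (hM : IsCoatom M) : M.index = p := by
  obtain ⟨m, hm⟩ := IsPGroup.iff_card.1 (hP.to_subgroup M)
  obtain ⟨k, hk⟩ := hP.index M
  have hk0 : k ≠ 0 := by
    rintro rfl
    exact hM.1 (index_eq_one.1 (by simpa using hk))
  have hmul := M.card_mul_index
  have hdvd : p ^ (m + 1) ∣ Nat.card P := by
    rw [← hmul, hm, hk, ← pow_add]
    exact pow_dvd_pow p (by omega)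
  obtain ⟨K, hK, hMK⟩ := Sylow.exists_subgroup_card_pow_succ hdvd hm
  have hlt : M < K := lt_of_le_of_ne hMK (by
    rintro rfl
    exact absurd (Nat.pow_right_injective hp.out.two_le (hK.symm.trans hm)) (by simp))
  have htop := hM.2 K hlt
  rw [htop, card_top, ← hmul, hm, pow_succ] at hK
  exact Nat.eq_of_mul_eq_mul_left (pow_pos hp.out.pos m) hK

theorem pow_mem_and_commutator_mem_of_isCoatom {P : Type*} [Group P] [Finite P] {p : ℕ}
    [hp : Fact p.Prime] (hP : IsPGroup p P) {M : Subgroup P} (hM : IsCoatom M) (x y : P) :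
    x ^ p ∈ M ∧ (y * x)⁻¹ * (x * y) ∈ M := by
  have hidx := index_eq_of_isCoatom hP hM
  have : Group.IsNilpotent P := hP.isNilpotent
  have : M.Normal := (Group.normalizerCondition_of_isNilpotent (G := P)).normal_of_coatom _ hM
  refine ⟨hidx ▸ M.pow_index_mem x, ?_⟩
  have : IsCyclic (P ⧸ M) := isCyclic_of_prime_card (p := p) (by rw [← hidx]; rfl)
  let _ : CommGroup (P ⧸ M) := IsCyclic.commGroup
  rw [← QuotientGroup.eq]
  exact mul_comm (y : P ⧸ M) (x : P ⧸ M)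

/-- In a minimal non-cyclic subgroup all maximal subgroups are cyclic, and there are at least two,
generated by `x` and `y`. Both are normal of index `p`, so each contains all `p`-th powers and
commutators. -/
theorem exists_pair_of_not_isCyclic {p : ℕ} [hp : Fact p.Prime] {P : Type*} [Group P] [Finite P]
    (hP : IsPGroup p P) (hcyc : ¬ IsCyclic P) :
    ∃ x y : P, x ∉ zpowers y ∧ y ∉ zpowers x ∧ x ^ p ∈ zpowers y ∧
      (y * x)⁻¹ * (x * y) ∈ zpowers x ∧ (y * x)⁻¹ * (x * y) ∈ zpowers y := by
  suffices h : ∀ H : Subgroup P, ¬ IsCyclic H → ∃ x y : P, x ∉ zpowers y ∧ y ∉ zpowers x ∧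
      x ^ p ∈ zpowers y ∧ (y * x)⁻¹ * (x * y) ∈ zpowers x ∧ (y * x)⁻¹ * (x * y) ∈ zpowers y by
    exact h ⊤ fun h ↦ hcyc (isCyclic_of_surjective _ topEquiv.surjective)
  intro H
  induction H using WellFoundedLT.induction with
  | ind H ih =>
  intro hH
  by_cases hmin : ∃ K < H, ¬ IsCyclic K
  · obtain ⟨K, hK, hKc⟩ := hmin
    exact ih K hK hKc
  push Not at hmin
  have hcycM : ∀ M : Subgroup H, M ≠ ⊤ → ∃ x, zpowers x = M := by
    intro M hM
    have : IsCyclic (M.map H.subtype) := hmin _ (by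
      refine lt_of_le_of_ne (map_subtype_le M) fun h ↦ hM ?_
      apply map_injective H.subtype_injective
      rw [h, ← MonoidHom.range_eq_map, range_subtype])
    have : IsCyclic M :=
      isCyclic_of_surjective _ (M.equivMapOfInjective _ H.subtype_injective).symm.surjective
    exact (Subgroup.isCyclic_iff_exists_zpowers_eq_top M).1 this
  have hne : ∀ x : H, zpowers x ≠ ⊤ := fun x hx ↦
    hH (isCyclic_iff_exists_zpowers_eq_top.2 ⟨x, hx⟩)
  obtain ⟨M, hM, -⟩ := (eq_top_or_exists_le_coatom (zpowers (1 : H))).resolve_left (hne 1)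
  obtain ⟨x, rfl⟩ := hcycM M hM.1
  obtain ⟨y₀, hy₀⟩ : ∃ y, y ∉ zpowers x := by
    by_contra! h
    exact hM.1 (eq_top_iff' _ |>.2 h)
  obtain ⟨N, hN, hyN⟩ := (eq_top_or_exists_le_coatom (zpowers y₀)).resolve_left (hne y₀)
  obtain ⟨y, rfl⟩ := hcycM N hN.1
  have hP' : IsPGroup p H := hP.to_subgroup H
  have hMN : zpowers x ≠ zpowers y := fun h ↦ hy₀ (h ▸ hyN (mem_zpowers y₀))
  have hmem : ∀ a b : H, (a : P) ∈ zpowers (b : P) ↔ a ∈ zpowers b := fun a b ↦ by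
    simp only [mem_zpowers_iff, Subtype.ext_iff, coe_zpow]
  refine ⟨x, y, ?_, ?_, ?_, ?_, ?_⟩
  · rw [hmem, ← zpowers_le]
    exact fun h ↦ hMN ((hM.le_iff_eq hN.1).1 h).symm
  · rw [hmem, ← zpowers_le]
    exact fun h ↦ hMN ((hN.le_iff_eq hM.1).1 h)
  · exact_mod_cast (hmem _ _).2 (pow_mem_and_commutator_mem_of_isCoatom hP' hN x y).1
  · exact_mod_cast (hmem _ _).2 (pow_mem_and_commutator_mem_of_isCoatom hP' hM x y).2
  · exact_mod_cast (hmem _ _).2 (pow_mem_and_commutator_mem_of_isCoatom hP' hN x y).2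

theorem mul_pow_of_mul_eq_mul_mul {G : Type*} [Group G] {x z d : G} (h : x * z = z * x * d)
    (hx : Commute d x) (hz : Commute d z) (n : ℕ) :
    x ^ n * z = z * x ^ n * d ^ n ∧ (z * x) ^ n = z ^ n * x ^ n * d ^ (n.choose 2) := by
  have h₁ : ∀ n : ℕ, x ^ n * z = z * x ^ n * d ^ n := by
    intro n
    induction n with
    | zero => simp
    | succ n ih =>
      calc x ^ (n + 1) * z = x ^ n * (x * z) := by rw [pow_succ, mul_assoc]
        _ = x ^ n * z * (x * d) := by rw [h]; simp only [mul_assoc]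
        _ = z * x ^ n * (d ^ n * x) * d := by rw [ih]; simp only [mul_assoc]
        _ = z * x ^ (n + 1) * d ^ (n + 1) := by
          rw [(hx.pow_left n).eq, pow_succ, pow_succ]; simp only [mul_assoc]
  refine ⟨h₁ n, ?_⟩
  induction n with
  | zero => simp
  | succ n ih =>
    calc (z * x) ^ (n + 1) = z ^ n * x ^ n * (d ^ n.choose 2 * z) * x := by
          rw [pow_succ, ih]; simp only [mul_assoc]
      _ = z ^ n * (x ^ n * z) * (d ^ n.choose 2 * x) := by
          rw [(hz.pow_left _).eq]; simp only [mul_assoc]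
      _ = z ^ n * z * x ^ n * (d ^ n * x) * d ^ n.choose 2 := by
          rw [h₁, (hx.pow_left _).eq]; simp only [mul_assoc]
      _ = z ^ (n + 1) * x ^ (n + 1) * d ^ ((n + 1).choose 2) := by
          rw [(hx.pow_left n).eq, Nat.choose_succ_succ' n 1, Nat.choose_one_right, pow_succ z n,
            pow_succ x n, pow_add]
          simp only [mul_assoc]

/-- If the subgroup of order `p` is unique, it lies in `zpowers y`. The element `x` is corrected by
a power of `y` to `z * x`, still outside `zpowers y`, whose `p`-th power is nearly trivial. This is
contradictory for odd `p` and yields a quaternion group for `p = 2`. -/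
theorem exists_prime_order_pair_or_quaternion {p : ℕ} [hp : Fact p.Prime] {P : Type*} [Group P]
    [Finite P] (hP : IsPGroup p P) (hcyc : ¬ IsCyclic P) :
    (∃ a b : P, a ^ p = 1 ∧ b ^ p = 1 ∧ a ≠ 1 ∧ b ∉ zpowers a) ∨
      ∃ u w : P, u ^ 4 = 1 ∧ u ^ 2 = w ^ 2 ∧ u * w = w * u * u ^ 2 ∧ ¬ Commute u w := by
  rw [or_iff_not_imp_left]
  intro hU
  push Not at hU
  obtain ⟨x, y, hxy, hyx, hxp, hcx, hcy⟩ := exists_pair_of_not_isCyclic hP hcyc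
  set c := (y * x)⁻¹ * (x * y) with hc
  have hxyc : x * y = y * x * c := by rw [hc, mul_inv_cancel_left]
  have hcx' : Commute c x := commute_of_mem_zpowers hcx (mem_zpowers x)
  have hcy' : Commute c y := commute_of_mem_zpowers hcy (mem_zpowers y)
  have hy1 : y ≠ 1 := by
    rintro rfl
    exact hyx (one_mem _)
  have hpy : p ∣ orderOf y := hP.dvd_orderOf hy1
  have hU' : ∀ w : P, w ^ p = 1 → w ∈ zpowers y := by
    intro w hw
    have h0 : orderOf y ≠ 0 := (orderOf_pos y).ne'
    have hord := orderOf_pow_orderOf_div h0 hpy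
    have hne : y ^ (orderOf y / p) ≠ 1 := by
      rw [ne_eq, ← orderOf_eq_one_iff, hord]
      exact hp.out.one_lt.ne'
    exact zpowers_le.2 (npow_mem_zpowers y _)
      (hU _ w (orderOf_dvd_iff_pow_eq_one.1 hord.dvd) hw hne)
  -- `x ^ p` is a power of `y`, so it commutes with `y`.
  have hcp : c ^ p = 1 := by
    have h := (mul_pow_of_mul_eq_mul_mul hxyc hcx' hcy' p).1
    rwa [(commute_of_mem_zpowers hxp (mem_zpowers y)).eq, left_eq_mul] at h
  obtain ⟨k, hk⟩ := hxp
  simp only at hk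
  -- Otherwise `y ^ k = x ^ p` would generate `y`.
  obtain ⟨s, rfl⟩ : (p : ℤ) ∣ k := by
    by_contra hpk
    refine hyx ?_
    have : y ∈ zpowers (y ^ k) := by
      obtain ⟨n, hn⟩ := IsPGroup.iff_orderOf.1 hP y
      rw [mem_zpowers_zpow_iff, ← Int.isCoprime_iff_gcd_eq_one, hn, Nat.cast_pow]
      exact (((Nat.prime_iff_prime_int.1 hp.out).coprime_iff_not_dvd.2 hpk).symm).pow_right
    rw [hk] at this
    exact zpowers_le.2 (npow_mem_zpowers x p) this
  set z := y ^ (-s) with hz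
  have hzy : z ∈ zpowers y := zpow_mem (mem_zpowers y) _
  have hzp : z ^ p * x ^ p = 1 := by
    rw [hz, ← hk, ← zpow_natCast, ← zpow_mul, ← zpow_add]
    simp [mul_comm]
  have hw : z * x ∉ zpowers y := fun h ↦ hxy ((mul_mem_cancel_left hzy).1 h)
  have hcomm : ∀ n : ℤ, x * y ^ n = y ^ n * x * c ^ n := by
    intro n
    have h : SemiconjBy x y (y * c) := by
      rw [SemiconjBy, hxyc, mul_assoc, mul_assoc, hcx'.eq]
    rw [(h.zpow_right n).eq, hcy'.symm.mul_zpow, mul_assoc, mul_assoc, (hcx'.zpow_left n).eq]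
  have hcn : ∀ n : ℤ, Commute (c ^ n) x ∧ Commute (c ^ n) z := fun n ↦
    ⟨hcx'.zpow_left n, hcy'.zpow_zpow _ _⟩
  set d := c ^ (-s) with hd
  have hwp : (z * x) ^ p = d ^ (p.choose 2) := by
    rw [(mul_pow_of_mul_eq_mul_mul (hcomm (-s)) (hcn _).1 (hcn _).2 p).2, hzp, one_mul]
  have hdp : d ^ p = 1 := by
    rw [hd, ← zpow_natCast, zpow_comm, zpow_natCast, hcp, one_zpow]
  -- For odd `p`, `p` divides `p.choose 2`, so `z * x` would be killed by `p`.
  have hp2 : p = 2 := by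
    by_contra hp2
    obtain ⟨m, hm⟩ := hp.out.dvd_choose_self two_ne_zero
      (lt_of_le_of_ne hp.out.two_le (Ne.symm hp2))
    refine hw (hU' _ ?_)
    rw [hwp, hm, pow_mul, hdp, one_pow]
  subst hp2
  set w := z * x with hw_def
  have hw2 : w ^ 2 = d := by simpa using hwp
  have hd1 : d ≠ 1 := fun h ↦ hw (hU' _ (by rw [hw2, h]))
  have hcd : d = c := (zpow_eq_one_or_self hcp (-s)).resolve_left hd1
  -- Otherwise `y ^ 2 = 1`, hence `x ^ 2 = 1`, putting `x` in `zpowers y`.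
  have h4y : 4 ∣ orderOf y := by
    obtain ⟨n, hn⟩ := IsPGroup.iff_orderOf.1 hP y
    by_contra h4
    have hn1 : n < 2 := by
      by_contra! h
      exact h4 (hn ▸ pow_dvd_pow 2 h)
    have hy2 : y ^ 2 = 1 := by
      rw [← orderOf_dvd_iff_pow_eq_one, hn]
      exact pow_dvd_pow 2 (Nat.le_of_lt_succ hn1) |>.trans (by simp)
    refine hxy (hU' x ?_)
    rw [← hk, zpow_mul]
    simp [show y ^ (2 : ℤ) = 1 by exact_mod_cast hy2]
  obtain ⟨u, huy, hu⟩ : ∃ u ∈ zpowers y, orderOf u = 4 :=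
    ⟨y ^ (orderOf y / 4), npow_mem_zpowers y _, orderOf_pow_orderOf_div (orderOf_pos y).ne' h4y⟩
  have hu4 : u ^ 4 = 1 := hu ▸ pow_orderOf_eq_one u
  have hu2 : u ^ 2 = d := by
    have hu2' : u ^ 2 ≠ 1 := pow_ne_one_of_lt_orderOf two_ne_zero (by omega)
    have hu22 : (u ^ 2) ^ 2 = 1 := by rw [← pow_mul]; exact hu4
    obtain ⟨n, hn⟩ := hU _ d hu22 hdp hu2'
    simp only at hn
    rcases zpow_eq_one_or_self hu22 n with h | h
    · exact absurd (hn.symm.trans h) hd1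
    · exact h.symm.trans hn
  -- If they commuted, `w * u⁻¹` would have trivial square and so lie in `zpowers y`, along with
  -- `w`.
  have hne : ¬ Commute u w := by
    intro h
    refine hw ?_
    have : w * u⁻¹ ∈ zpowers y := by
      refine hU' _ ?_
      rw [h.symm.inv_right.mul_pow, inv_pow, hw2, hu2, mul_inv_cancel]
    exact (mul_mem_cancel_right (inv_mem huy)).1 this
  refine ⟨u, w, hu4, by rw [hu2, hw2], ?_, hne⟩
  have hrel : ∃ n : ℤ, u * w = w * u * c ^ n := by
    have hzu : Commute z u := commute_of_mem_zpowers hzy huy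
    obtain ⟨m, rfl⟩ := huy
    refine ⟨-m, ?_⟩
    rw [hw_def, ← mul_assoc, ← hzu.eq, mul_assoc z, mul_assoc z, mul_assoc z, hcomm, zpow_neg,
      mul_inv_cancel_right]
  obtain ⟨n, hn⟩ := hrel
  rcases zpow_eq_one_or_self hcp n with h | h
  · rw [h, mul_one] at hn
    exact absurd hn hne
  · rw [hn, h, hu2, hcd]

end PGroup

end OrientedDiameter

open OrientedDiameter in
theorem mainTheorem5 {G : Type*} [Group G] [Finite G] (hnil : Group.IsNilpotent G)
    (hcyc : ¬ IsCyclic G) (hpp : ¬ IsPrimePow (Nat.card G)) :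
    3 ≤ OrientedDiameter.orientedDiam (OrientedDiameter.powerGraph G) := by
  have hZ : ¬ IsZGroup G := fun _ ↦ hcyc inferInstance
  rw [isZGroup_iff] at hZ
  push Not at hZ
  obtain ⟨p, hp, S, hS⟩ := hZ
  have := Fact.mk hp
  rcases exists_prime_order_pair_or_quaternion S.isPGroup' hS with
    ⟨a, b, ha, hb, ha1, hab⟩ | ⟨u, w, hu, huw, hrel, hne⟩
  · refine three_le_orientedDiam_of_prime_order hp (a := (a : G)) (b := b) (by exact_mod_cast ha)
      (by exact_mod_cast hb) (by exact_mod_cast ha1) ?_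
    simpa only [Subgroup.mem_zpowers_iff, Subtype.ext_iff, Subgroup.coe_zpow] using hab
  · refine three_le_orientedDiam_of_quaternion (u := (u : G)) (w := w) (by exact_mod_cast hu)
      (by exact_mod_cast huw) (by exact_mod_cast hrel) ?_
    rw [commute_iff_eq] at hne ⊢
    exact_mod_cast hne
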